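/- Let $(X_i)_{i\ge 1}$ be identically distributed real random variables on a probability space $(\Omega,\mathcal F,\mathbb P)$, with distribution function $F$. For $n\ge 1$ let $$\widehat F_n(x):=\frac1n\sum_{i=1}^n \mathbf 1_{[X_i,\infty)}(x),\qquad x\in\mathbb R,$$ be the empirical distribution function, and let $$\alpha(n):=\sup_{k\ge 1}\ \sup\bigl\{|\mathbb P[A\cap B]-\mathbb P[A]\,\mathbb P[B]| : A\in\sigma(X_1,\dots,X_k),\ B\in\sigma(X_{k+n},X_{k+n+1},\dots)\bigr\}$$ be the mixing coefficients. Let $r\in[0,\tfrac12)$. Suppose that $(X_i)$ is $\alpha$-mixing, i.e. $\alpha(n)\to 0$ as $n\to\infty$, and that there are constants $K>0$ and $\vartheta>2r$ with $\alpha(n)\le K n^{-\vartheta}$ for all $n\ge 1$. Then $$n^{r}\,\sup_{x\in\mathbb R}\bigl|\widehat F_n(x)-F(x)\bigr|\longrightarrow 0\quad\text{as } n\to\infty,\qquad \mathbb P\text{-almost surely}.$$ -/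

import Mathlib

open MeasureTheory ProbabilityTheory Filter Topology

noncomputable section

namespace EmpiricalMixing

variable {Ω : Type*}

/-- The sigma-algebra generated by the initial segment `X 0, …, X m`. -/
@[reducible]
def pastSigma (X : ℕ → Ω → ℝ) (m : ℕ) : MeasurableSpace Ω :=
  ⨆ i ∈ Set.Iic m, MeasurableSpace.comap (X i) (inferInstance : MeasurableSpace ℝ)

/-- The sigma-algebra generated by the tail segment `X m, X (m + 1), …`. -/
@[reducible]
def futureSigma (X : ℕ → Ω → ℝ) (m : ℕ) : MeasurableSpace Ω :=
  ⨆ i ∈ Set.Ici m, MeasurableSpace.comap (X i) (inferInstance : MeasurableSpace ℝ)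

/-- All values `|P(A ∩ B) - P(A) P(B)|`, with `A` in the past up to some time `k`
and `B` in the future from time `k + n` on. -/
def alphaValues [MeasurableSpace Ω] (μ : Measure Ω) (X : ℕ → Ω → ℝ) (n : ℕ) : Set ℝ :=
  {a | ∃ (k : ℕ) (A B : Set Ω), MeasurableSet[pastSigma X k] A ∧
    MeasurableSet[futureSigma X (k + n)] B ∧
    a = |μ.real (A ∩ B) - μ.real A * μ.real B|}

/-- The strong mixing coefficient `α(n)` of the sequence `X` (Rosenblatt). The sequence is
indexed from `0`, so that `X i` plays the role of the `(i + 1)`-st random variable. -/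
def alphaCoeff [MeasurableSpace Ω] (μ : Measure Ω) (X : ℕ → Ω → ℝ) (n : ℕ) : ℝ :=
  sSup (alphaValues μ X n)

/-- The supremum in `alphaCoeff` is over a nonempty set. -/
theorem alphaValues_nonempty [MeasurableSpace Ω] (μ : Measure Ω) (X : ℕ → Ω → ℝ) (n : ℕ) :
    (alphaValues μ X n).Nonempty :=
  ⟨_, 0, ∅, ∅, (pastSigma X 0).measurableSet_empty,
    (futureSigma X (0 + n)).measurableSet_empty, rfl⟩

/-- The supremum in `alphaCoeff` is over a bounded set. -/
theorem alphaValues_bddAbove [MeasurableSpace Ω] (μ : Measure Ω) [IsProbabilityMeasure μ]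
    (X : ℕ → Ω → ℝ) (n : ℕ) : BddAbove (alphaValues μ X n) := by
  refine ⟨1, ?_⟩
  rintro a ⟨k, A, B, -, -, rfl⟩
  have h1 : μ.real (A ∩ B) ≤ 1 := measureReal_le_one
  have h2 : μ.real A ≤ 1 := measureReal_le_one
  have h3 : μ.real B ≤ 1 := measureReal_le_one
  have h4 : 0 ≤ μ.real (A ∩ B) := measureReal_nonneg
  have h5 : 0 ≤ μ.real A := measureReal_nonneg
  have h6 : 0 ≤ μ.real B := measureReal_nonneg
  rw [abs_le]
  constructor <;> nlinarith [mul_nonneg h5 h6, mul_le_one₀ h2 h6 h3]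

/-- The sequence `X` is `α`-mixing (strongly mixing): `α(n) → 0`. -/
def IsAlphaMixing [MeasurableSpace Ω] (μ : Measure Ω) (X : ℕ → Ω → ℝ) : Prop :=
  Tendsto (alphaCoeff μ X) atTop (𝓝 0)

/-- The empirical distribution function `(1/n) ∑ 1_{[X_i, ∞)}` of the first `n` observations,
at the sample point `ω`. -/
def empiricalCDF (X : ℕ → Ω → ℝ) (n : ℕ) (ω : Ω) (x : ℝ) : ℝ :=
  (1 / (n : ℝ)) * ∑ i ∈ Finset.range n, (Set.Ici (X i ω)).indicator (fun _ => (1 : ℝ)) x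

/-- The uniform sup-norm `‖f‖_∞ = sup_x |f x|` of a bounded function on the real line. -/
def supNorm (f : ℝ → ℝ) : ℝ := ⨆ x : ℝ, |f x|

/-- The supremum in `‖F̂_n - F‖_∞` is over a bounded set. -/
theorem bddAbove_empiricalCDF_sub_cdf (X : ℕ → Ω → ℝ) (n : ℕ) (ω : Ω) (ν : Measure ℝ) :
    BddAbove (Set.range fun x : ℝ => |empiricalCDF X n ω x - cdf ν x|) := by
  refine ⟨1, ?_⟩
  rintro a ⟨x, rfl⟩
  have h1 := cdf_nonneg ν x
  have h2 := cdf_le_one ν x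
  have hb : ∀ i, 0 ≤ (Set.Ici (X i ω)).indicator (fun _ => (1 : ℝ)) x ∧
      (Set.Ici (X i ω)).indicator (fun _ => (1 : ℝ)) x ≤ 1 := by
    intro i
    by_cases h : x ∈ Set.Ici (X i ω) <;> simp [h]
  have h3 : 0 ≤ empiricalCDF X n ω x :=
    mul_nonneg (by positivity) (Finset.sum_nonneg fun i _ => (hb i).1)
  have h4 : empiricalCDF X n ω x ≤ 1 := by
    have hs : ∑ i ∈ Finset.range n, (Set.Ici (X i ω)).indicator (fun _ => (1 : ℝ)) x ≤ n := by
      simpa using Finset.sum_le_sum (s := Finset.range n) fun i _ => (hb i).2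
    unfold empiricalCDF
    rw [one_div_mul_eq_div]
    exact div_le_one_of_le₀ hs (Nat.cast_nonneg n)
  simp only [abs_le]
  constructor <;> linarith

end EmpiricalMixing

end

/-!
The deviation is controlled simultaneously for all `n < 2 ^ m` and all `x` by a second-moment
chaining argument in two parameters, time and quantile level.

Cut the line by the quantile labels `h(y) = ⌈2 ^ m F(y)⌉`, respectively `⌈2 ^ m F(y-)⌉`; both are
needed because `F` may have atoms. Every half-line is bracketed, up to `F`-mass `2 ^ (-m)`, by sets
`{h < k}` (`abs_empiricalCDF_sub_cdf_le`), so it suffices to bound the centred counts of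
`{i < n : h (X i) < k}`. Writing `n` and `k` in binary and applying Cauchy–Schwarz in each
parameter, the square of such a count is at most the `dyadicEnergy`: a factor polynomial in `m`
times the sum of the squared centred counts over all products of a dyadic time block and a dyadic
label block (`sq_sum_range_sum_range_le_dyadic`).

The point that yields every `r < θ / 2`, however small the margin, is that summing second moments over the label blocks of one
level costs nothing (`sum_integral_sq_deviation_le`). Averaged over random unions of blocks, the
squared count of a union is at least a quarter of the sum of the squared counts of the blocks
(`two_pow_card_mul_sum_sq_le`), while the second moment for each single union is at most
`∑ i, ∑ j, α(|i - j|)` over the time block. Summed over the time blocks of one level, the latter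
is at most the double sum over `[0, 2 ^ m)`, which is `O(2 ^ (m (2 - θ)))` when `θ < 1`, as one may
assume. Hence the energy divided by `2 ^ (2 m (1 - r))` has expectation
`O(m ^ 4 * 2 ^ (-m (θ - 2 r)))`, which is summable in `m`, and it tends to `0` almost surely
(`ae_tendsto_dyadicEnergy`). For `2 ^ (m - 1) ≤ n < 2 ^ m` this is the claim.
-/

namespace EmpiricalMixing

/-! ### Dyadic blocks and the Rademacher–Menshov inequality -/

/-- The `q`-th dyadic block of length `2 ^ a` in `ℕ`. -/
def dyadicBlock (a q : ℕ) : Finset ℕ := Finset.Ico (q * 2 ^ a) ((q + 1) * 2 ^ a)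

theorem mem_dyadicBlock {a q i : ℕ} : i ∈ dyadicBlock a q ↔ i / 2 ^ a = q := by
  have h : 0 < 2 ^ a := by positivity
  rw [dyadicBlock, Finset.mem_Ico, ← Nat.le_div_iff_mul_le h, ← Nat.div_lt_iff_lt_mul h]
  omega

theorem pairwiseDisjoint_dyadicBlock (a : ℕ) (s : Set ℕ) :
    s.PairwiseDisjoint (dyadicBlock a) := by
  intro p _ q _ hpq
  refine Finset.disjoint_left.2 fun i hi hi' => hpq ?_
  rw [← mem_dyadicBlock.1 hi, ← mem_dyadicBlock.1 hi']

theorem dyadicBlock_subset_range {a m q : ℕ} (ham : a ≤ m) (hq : q < 2 ^ (m - a)) :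
    dyadicBlock a q ⊆ Finset.range (2 ^ m) := by
  intro i hi
  rw [dyadicBlock, Finset.mem_Ico] at hi
  have h : (q + 1) * 2 ^ a ≤ 2 ^ (m - a) * 2 ^ a := Nat.mul_le_mul_right _ hq
  rw [← pow_add, Nat.sub_add_cancel ham] at h
  exact Finset.mem_range.2 (hi.2.trans_le h)

/-- Chaining in one parameter: the prefix sums up to the successive binary truncations of `n`
differ by at most one dyadic block sum, so Cauchy–Schwarz bounds the square of any prefix sum by
the number of levels times the sum of the squares of all dyadic block sums. -/
theorem sq_sum_range_le_dyadic (u : ℕ → ℝ) {m n : ℕ} (hn : n < 2 ^ m) :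
    (∑ i ∈ Finset.range n, u i) ^ 2 ≤
      m * ∑ a ∈ Finset.range m, ∑ q ∈ Finset.range (2 ^ (m - a)),
        (∑ i ∈ dyadicBlock a q, u i) ^ 2 := by
  let P : ℕ → ℝ := fun a => ∑ i ∈ Finset.range (n / 2 ^ a * 2 ^ a), u i
  have hP : ∑ i ∈ Finset.range n, u i = ∑ a ∈ Finset.range m, (P a - P (a + 1)) := by
    rw [Finset.sum_range_sub']
    simp [P, Nat.div_eq_of_lt hn]
  rw [hP]
  refine sq_sum_le_card_mul_sum_sq.trans ?_
  rw [Finset.card_range]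
  refine mul_le_mul_of_nonneg_left (Finset.sum_le_sum fun a ha => ?_) (Nat.cast_nonneg m)
  have ham : a < m := Finset.mem_range.1 ha
  have hc : n / 2 ^ a < 2 ^ (m - a) := by
    refine Nat.div_lt_of_lt_mul ?_
    rwa [← pow_add, Nat.add_sub_cancel' ham.le]
  have hdiv : n / 2 ^ (a + 1) = n / 2 ^ a / 2 := by rw [Nat.div_div_eq_div_mul, pow_succ]
  rcases Nat.even_or_odd' (n / 2 ^ a) with ⟨e, he | he⟩
  · have h0 : P a - P (a + 1) = 0 := by
      have : n / 2 ^ a * 2 ^ a = n / 2 ^ (a + 1) * 2 ^ (a + 1) := by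
        rw [hdiv, he, pow_succ, Nat.mul_div_cancel_left _ two_pos]; ring
      simp only [P]
      rw [this, sub_self]
    rw [h0, zero_pow two_ne_zero]
    positivity
  · have h1 : P a - P (a + 1) = ∑ i ∈ dyadicBlock a (2 * e), u i := by
      have h2 : n / 2 ^ (a + 1) * 2 ^ (a + 1) = 2 * e * 2 ^ a := by
        rw [hdiv, he, pow_succ, show (2 * e + 1) / 2 = e by omega]; ring
      simp only [P, dyadicBlock]
      rw [h2, he, Finset.sum_Ico_eq_sub _ (Nat.mul_le_mul_right _ (Nat.le_succ _))]
    rw [h1]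
    exact Finset.single_le_sum (f := fun q => (∑ i ∈ dyadicBlock a q, u i) ^ 2)
      (fun _ _ => sq_nonneg _) (Finset.mem_range.2 (by omega))

/-- Chaining in two parameters, by applying the one-parameter inequality first to the rows of an
array and then to its columns. -/
theorem sq_sum_range_sum_range_le_dyadic (d : ℕ → ℕ → ℝ) {m n L k : ℕ} (hn : n < 2 ^ m)
    (hk : k < 2 ^ L) :
    (∑ i ∈ Finset.range n, ∑ y ∈ Finset.range k, d i y) ^ 2 ≤
      m * ∑ a ∈ Finset.range m, ∑ q ∈ Finset.range (2 ^ (m - a)),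
        (L * ∑ b ∈ Finset.range L, ∑ p ∈ Finset.range (2 ^ (L - b)),
          (∑ i ∈ dyadicBlock a q, ∑ y ∈ dyadicBlock b p, d i y) ^ 2) := by
  refine (sq_sum_range_le_dyadic _ hn).trans ?_
  gcongr with a _ q _
  have h := sq_sum_range_le_dyadic (fun y => ∑ i ∈ dyadicBlock a q, d i y) hk
  have hcomm : ∀ T : Finset ℕ, ∑ y ∈ T, ∑ i ∈ dyadicBlock a q, d i y =
      ∑ i ∈ dyadicBlock a q, ∑ y ∈ T, d i y := fun T => Finset.sum_comm
  simpa only [hcomm] using h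

theorem sum_dyadicBlock_le {c : ℕ → ℕ → ℝ} (hc : ∀ i j, 0 ≤ c i j) {a m : ℕ} (ham : a ≤ m) :
    ∑ q ∈ Finset.range (2 ^ (m - a)), ∑ i ∈ dyadicBlock a q, ∑ j ∈ dyadicBlock a q, c i j ≤
      ∑ i ∈ Finset.range (2 ^ m), ∑ j ∈ Finset.range (2 ^ m), c i j := by
  have hsub : ∀ q ∈ Finset.range (2 ^ (m - a)), dyadicBlock a q ⊆ Finset.range (2 ^ m) :=
    fun q hq => dyadicBlock_subset_range ham (Finset.mem_range.1 hq)
  calc _ ≤ ∑ q ∈ Finset.range (2 ^ (m - a)), ∑ i ∈ dyadicBlock a q,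
        ∑ j ∈ Finset.range (2 ^ m), c i j :=
        Finset.sum_le_sum fun q hq => Finset.sum_le_sum fun i _ =>
          Finset.sum_le_sum_of_subset_of_nonneg (hsub q hq) fun j _ _ => hc i j
    _ = ∑ i ∈ (Finset.range (2 ^ (m - a))).biUnion (dyadicBlock a),
        ∑ j ∈ Finset.range (2 ^ m), c i j :=
        (Finset.sum_biUnion (pairwiseDisjoint_dyadicBlock a _)).symm
    _ ≤ _ := Finset.sum_le_sum_of_subset_of_nonneg (Finset.biUnion_subset.2 hsub)
        fun i _ _ => Finset.sum_nonneg fun j _ => hc i j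

/-! ### Second moments of centred counts -/

/-- Averaging over random subsets: the mean of `(x + ∑ i ∈ T, z i) ^ 2` over a uniformly random
`T ⊆ s` is at least its variance `(∑ i ∈ s, z i ^ 2) / 4`. -/
theorem two_pow_card_mul_sum_sq_le {ι : Type*} [DecidableEq ι] (s : Finset ι) (z : ι → ℝ)
    (x : ℝ) :
    2 ^ s.card * ∑ i ∈ s, z i ^ 2 ≤ 4 * ∑ T ∈ s.powerset, (x + ∑ i ∈ T, z i) ^ 2 := by
  induction s using Finset.induction_on generalizing x with
  | empty => simpa using sq_nonneg x
  | insert e s he ih =>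
    rw [Finset.sum_powerset_insert he, Finset.card_insert_of_notMem he, Finset.sum_insert he]
    have h : ∑ T ∈ s.powerset, (2 * (x + z e / 2 + ∑ i ∈ T, z i) ^ 2 + z e ^ 2 / 2) =
        ∑ T ∈ s.powerset, (x + ∑ i ∈ T, z i) ^ 2 +
          ∑ T ∈ s.powerset, (x + ∑ i ∈ insert e T, z i) ^ 2 := by
      rw [← Finset.sum_add_distrib]
      refine Finset.sum_congr rfl fun T hT => ?_
      rw [Finset.sum_insert fun h => he (Finset.mem_powerset.1 hT h)]
      ring
    rw [← h, Finset.sum_add_distrib, ← Finset.mul_sum, Finset.sum_const, Finset.card_powerset,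
      nsmul_eq_mul]
    have := ih (x + z e / 2)
    push_cast
    rw [pow_succ]
    linarith

variable {Ω : Type*} [MeasurableSpace Ω]

/-- The centred indicator of the event `Y i = y`. -/
noncomputable def deviation (μ : Measure Ω) (Y : ℕ → Ω → ℕ) (i y : ℕ) (ω : Ω) : ℝ :=
  (Y i ⁻¹' {y}).indicator 1 ω - μ.real (Y i ⁻¹' {y})

theorem memLp_deviation (μ : Measure Ω) [IsProbabilityMeasure μ] {Y : ℕ → Ω → ℕ}
    (hY : ∀ i, Measurable (Y i)) (i y : ℕ) : MemLp (deviation μ Y i y) 2 μ :=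
  (memLp_indicator_const 2 (hY i (measurableSet_singleton y)) (1 : ℝ)
    (Or.inr (measure_ne_top _ _))).sub (memLp_const _)

theorem integrable_sq_sum_deviation (μ : Measure Ω) [IsProbabilityMeasure μ] {Y : ℕ → Ω → ℕ}
    (hY : ∀ i, Measurable (Y i)) (J U : Finset ℕ) :
    Integrable (fun ω => (∑ i ∈ J, ∑ y ∈ U, deviation μ Y i y ω) ^ 2) μ := by
  refine MemLp.integrable_sq ?_
  exact memLp_finsetSum _ fun i _ => memLp_finsetSum _ fun y _ => memLp_deviation μ hY i y

theorem sum_deviation (μ : Measure Ω) [IsProbabilityMeasure μ] {Y : ℕ → Ω → ℕ}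
    (hY : ∀ i, Measurable (Y i)) (i : ℕ) (U : Finset ℕ) (ω : Ω) :
    ∑ y ∈ U, deviation μ Y i y ω =
      (Y i ⁻¹' U).indicator 1 ω - μ.real (Y i ⁻¹' U) := by
  have h1 : ∑ y ∈ U, μ.real (Y i ⁻¹' {y}) = μ.real (Y i ⁻¹' U) :=
    sum_measureReal_preimage_singleton U fun y _ => hY i (measurableSet_singleton y)
  simp only [deviation]
  rw [Finset.sum_sub_distrib, h1]
  refine congrArg (· - _) ?_
  classical
  simp [Set.indicator_apply]

theorem integral_sq_sum_centred_indicator_le (μ : Measure Ω) [IsProbabilityMeasure μ]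
    {A : ℕ → Set Ω} (hA : ∀ i, MeasurableSet (A i)) {c : ℕ → ℕ → ℝ}
    (hc : ∀ i j, μ.real (A i ∩ A j) - μ.real (A i) * μ.real (A j) ≤ c i j) (J : Finset ℕ) :
    ∫ ω, (∑ i ∈ J, ((A i).indicator 1 ω - μ.real (A i))) ^ 2 ∂μ ≤
      ∑ i ∈ J, ∑ j ∈ J, c i j := by
  have h1 : ∀ i, Integrable (fun ω => (A i).indicator (1 : Ω → ℝ) ω) μ := fun i =>
    (integrable_const (1 : ℝ)).indicator (hA i)
  have h2 : ∀ i j, Integrable (fun ω => (A i ∩ A j).indicator (1 : Ω → ℝ) ω) μ := fun i j =>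
    (integrable_const (1 : ℝ)).indicator ((hA i).inter (hA j))
  have h3 : ∀ i j, Integrable (fun ω => (A i ∩ A j).indicator (1 : Ω → ℝ) ω -
      μ.real (A j) * (A i).indicator 1 ω) μ := fun i j => (h2 i j).sub ((h1 i).const_mul _)
  have h4 : ∀ i j, Integrable (fun ω => (A i ∩ A j).indicator (1 : Ω → ℝ) ω -
      μ.real (A j) * (A i).indicator 1 ω - μ.real (A i) * (A j).indicator 1 ω) μ :=
    fun i j => (h3 i j).sub ((h1 j).const_mul _)
  have hprod : ∀ i j, ∀ ω, ((A i).indicator (1 : Ω → ℝ) ω - μ.real (A i)) *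
      ((A j).indicator 1 ω - μ.real (A j)) =
      (A i ∩ A j).indicator 1 ω - μ.real (A j) * (A i).indicator 1 ω -
        μ.real (A i) * (A j).indicator 1 ω + μ.real (A i) * μ.real (A j) := by
    intro i j ω
    rw [Set.inter_indicator_one, Pi.mul_apply]
    ring
  have hI : ∀ i j, Integrable (fun ω => ((A i).indicator (1 : Ω → ℝ) ω - μ.real (A i)) *
      ((A j).indicator 1 ω - μ.real (A j))) μ := by
    intro i j
    simp only [hprod]
    exact (h4 i j).add (integrable_const _)
  have hV : ∀ i j, ∫ ω, ((A i).indicator (1 : Ω → ℝ) ω - μ.real (A i)) *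
      ((A j).indicator 1 ω - μ.real (A j)) ∂μ =
      μ.real (A i ∩ A j) - μ.real (A i) * μ.real (A j) := by
    intro i j
    simp only [hprod]
    rw [integral_add (h4 i j) (integrable_const _), integral_sub (h3 i j) ((h1 j).const_mul _),
      integral_sub (h2 i j) ((h1 i).const_mul _), integral_const_mul, integral_const_mul,
      integral_indicator_one ((hA i).inter (hA j)), integral_indicator_one (hA i),
      integral_indicator_one (hA j)]
    simp
    ring
  simp only [sq, Finset.sum_mul_sum]
  rw [integral_finsetSum _ fun i _ => integrable_finsetSum _ fun j _ => hI i j]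
  refine Finset.sum_le_sum fun i _ => ?_
  rw [integral_finsetSum _ fun j _ => hI i j]
  exact Finset.sum_le_sum fun j _ => (hV i j).trans_le (hc i j)

/-- The second moments of the centred counts over *all* label blocks of one level add up to no
more than four times the bound for a *single* set of labels: averaging over unions of random
families of blocks replaces the sum over the blocks, so no factor counting the blocks appears. -/
theorem sum_integral_sq_deviation_le (μ : Measure Ω) [IsProbabilityMeasure μ] {Y : ℕ → Ω → ℕ}
    (hY : ∀ i, Measurable (Y i)) {c : ℕ → ℕ → ℝ}
    (hc : ∀ (U : Set ℕ) i j, μ.real (Y i ⁻¹' U ∩ Y j ⁻¹' U) -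
      μ.real (Y i ⁻¹' U) * μ.real (Y j ⁻¹' U) ≤ c i j) (J : Finset ℕ) (b P : ℕ) :
    ∑ p ∈ Finset.range P, ∫ ω, (∑ i ∈ J, ∑ y ∈ dyadicBlock b p, deviation μ Y i y ω) ^ 2 ∂μ ≤
      4 * ∑ i ∈ J, ∑ j ∈ J, c i j := by
  have hT : ∀ T : Finset ℕ, ∀ ω,
      0 + ∑ p ∈ T, ∑ i ∈ J, ∑ y ∈ dyadicBlock b p, deviation μ Y i y ω =
        ∑ i ∈ J, ∑ y ∈ T.biUnion (dyadicBlock b), deviation μ Y i y ω := by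
    intro T ω
    rw [zero_add, Finset.sum_comm]
    exact Finset.sum_congr rfl fun i _ =>
      (Finset.sum_biUnion (pairwiseDisjoint_dyadicBlock b _)).symm
  have hE : ∀ U : Finset ℕ, ∫ ω, (∑ i ∈ J, ∑ y ∈ U, deviation μ Y i y ω) ^ 2 ∂μ ≤
      ∑ i ∈ J, ∑ j ∈ J, c i j := by
    intro U
    simp only [sum_deviation μ hY]
    exact integral_sq_sum_centred_indicator_le μ
      (fun i => hY i U.measurableSet) (hc U) J
  have hI := integrable_sq_sum_deviation μ hY J
  have key := integral_mono (μ := μ)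
    (((integrable_finsetSum (Finset.range P) fun p _ => hI (dyadicBlock b p))).const_mul
      (2 ^ (Finset.range P).card))
    ((integrable_finsetSum (Finset.range P).powerset fun T _ =>
      hI (T.biUnion (dyadicBlock b))).const_mul 4)
    (fun ω => by
      have := two_pow_card_mul_sum_sq_le (Finset.range P)
        (fun p => ∑ i ∈ J, ∑ y ∈ dyadicBlock b p, deviation μ Y i y ω) 0
      simpa only [hT] using this)
  rw [integral_const_mul, integral_const_mul, integral_finsetSum _ fun p _ => hI _,
    integral_finsetSum _ fun T _ => hI _] at key
  have hsum := Finset.sum_le_card_nsmul (Finset.range P).powerset _ _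
    fun T _ => hE (T.biUnion (dyadicBlock b))
  rw [Finset.card_powerset, nsmul_eq_mul] at hsum
  push_cast at hsum
  have hpos : (0 : ℝ) < 2 ^ (Finset.range P).card := by positivity
  refine le_of_mul_le_mul_left ?_ hpos
  linarith

/-- The sum of the squares of the centred counts over all dyadic time blocks in `[0, 2 ^ m)` and
all dyadic label blocks in `[0, 2 ^ L)`, with the Cauchy–Schwarz factors that make it dominate
the square of every count over a rectangle `[0, n) × [0, k)`. -/
noncomputable def dyadicEnergy (μ : Measure Ω) (Y : ℕ → Ω → ℕ) (m L : ℕ) (ω : Ω) : ℝ :=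
  m * ∑ a ∈ Finset.range m, ∑ q ∈ Finset.range (2 ^ (m - a)),
    (L * ∑ b ∈ Finset.range L, ∑ p ∈ Finset.range (2 ^ (L - b)),
      (∑ i ∈ dyadicBlock a q, ∑ y ∈ dyadicBlock b p, deviation μ Y i y ω) ^ 2)

theorem dyadicEnergy_nonneg (μ : Measure Ω) (Y : ℕ → Ω → ℕ) (m L : ℕ) (ω : Ω) :
    0 ≤ dyadicEnergy μ Y m L ω := by
  unfold dyadicEnergy
  positivity

theorem integrable_dyadicEnergy (μ : Measure Ω) [IsProbabilityMeasure μ] {Y : ℕ → Ω → ℕ}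
    (hY : ∀ i, Measurable (Y i)) (m L : ℕ) : Integrable (dyadicEnergy μ Y m L) μ := by
  refine Integrable.const_mul (integrable_finsetSum _ fun a _ => integrable_finsetSum _
    fun q _ => Integrable.const_mul (integrable_finsetSum _ fun b _ => integrable_finsetSum _
    fun p _ => integrable_sq_sum_deviation μ hY _ _) _) _

theorem integral_dyadicEnergy_le (μ : Measure Ω) [IsProbabilityMeasure μ] {Y : ℕ → Ω → ℕ}
    (hY : ∀ i, Measurable (Y i)) {c : ℕ → ℕ → ℝ} (hc0 : ∀ i j, 0 ≤ c i j)
    (hc : ∀ (U : Set ℕ) i j, μ.real (Y i ⁻¹' U ∩ Y j ⁻¹' U) -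
      μ.real (Y i ⁻¹' U) * μ.real (Y j ⁻¹' U) ≤ c i j) (m L : ℕ) :
    ∫ ω, dyadicEnergy μ Y m L ω ∂μ ≤
      4 * (m : ℝ) ^ 2 * (L : ℝ) ^ 2 *
        ∑ i ∈ Finset.range (2 ^ m), ∑ j ∈ Finset.range (2 ^ m), c i j := by
  have hI := fun a q b p =>
    integrable_sq_sum_deviation μ hY (dyadicBlock a q) (dyadicBlock b p)
  have hI1 := fun a q b => integrable_finsetSum (Finset.range (2 ^ (L - b)))
    fun p _ => hI a q b p
  have hI2 := fun a q => (integrable_finsetSum (Finset.range L)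
    fun b _ => hI1 a q b).const_mul (L : ℝ)
  have hI3 := fun a => integrable_finsetSum (Finset.range (2 ^ (m - a)))
    fun q _ => hI2 a q
  set C := ∑ i ∈ Finset.range (2 ^ m), ∑ j ∈ Finset.range (2 ^ m), c i j
  have h2 : ∀ a q, ∫ ω, (L * ∑ b ∈ Finset.range L, ∑ p ∈ Finset.range (2 ^ (L - b)),
      (∑ i ∈ dyadicBlock a q, ∑ y ∈ dyadicBlock b p, deviation μ Y i y ω) ^ 2) ∂μ ≤
      4 * (L : ℝ) ^ 2 * ∑ i ∈ dyadicBlock a q, ∑ j ∈ dyadicBlock a q, c i j := by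
    intro a q
    rw [integral_const_mul, integral_finsetSum _ fun b _ => hI1 a q b]
    have := Finset.sum_le_card_nsmul (Finset.range L) _ _ fun b _ =>
      (integral_finsetSum _ fun p _ => hI a q b p).trans_le
        (sum_integral_sq_deviation_le μ hY hc (dyadicBlock a q) b (2 ^ (L - b)))
    rw [Finset.card_range, nsmul_eq_mul] at this
    refine (mul_le_mul_of_nonneg_left this (Nat.cast_nonneg L)).trans_eq ?_
    ring
  have h3 : ∀ a ∈ Finset.range m, ∫ ω, ∑ q ∈ Finset.range (2 ^ (m - a)),
      (L * ∑ b ∈ Finset.range L, ∑ p ∈ Finset.range (2 ^ (L - b)),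
      (∑ i ∈ dyadicBlock a q, ∑ y ∈ dyadicBlock b p, deviation μ Y i y ω) ^ 2) ∂μ ≤
      4 * (L : ℝ) ^ 2 * C := by
    intro a ha
    rw [integral_finsetSum _ fun q _ => hI2 a q]
    refine (Finset.sum_le_sum fun q _ => h2 a q).trans ?_
    rw [← Finset.mul_sum]
    exact mul_le_mul_of_nonneg_left (sum_dyadicBlock_le hc0 (Finset.mem_range.1 ha).le)
      (by positivity)
  unfold dyadicEnergy
  rw [integral_const_mul, integral_finsetSum _ fun a _ => hI3 a]
  have := Finset.sum_le_card_nsmul (Finset.range m) _ _ h3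
  rw [Finset.card_range, nsmul_eq_mul] at this
  refine (mul_le_mul_of_nonneg_left this (Nat.cast_nonneg m)).trans_eq ?_
  ring

theorem sq_sum_deviation_le_dyadicEnergy (μ : Measure Ω) (Y : ℕ → Ω → ℕ) {m n L k : ℕ}
    (hn : n < 2 ^ m) (hk : k < 2 ^ L) (ω : Ω) :
    (∑ i ∈ Finset.range n, ∑ y ∈ Finset.range k, deviation μ Y i y ω) ^ 2 ≤
      dyadicEnergy μ Y m L ω :=
  sq_sum_range_sum_range_le_dyadic (fun i y => deviation μ Y i y ω) hn hk

/-! ### Sums of mixing coefficients -/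

theorem sum_sum_dist_le {f : ℕ → ℝ} (hf : ∀ d, 0 ≤ f d) (M : ℕ) :
    ∑ i ∈ Finset.range M, ∑ j ∈ Finset.range M, f (i - j + (j - i)) ≤
      2 * M * ∑ d ∈ Finset.range M, f d := by
  have hmono : ∀ {s}, s ≤ M → ∑ d ∈ Finset.range s, f d ≤ ∑ d ∈ Finset.range M, f d :=
    fun hs => Finset.sum_le_sum_of_subset_of_nonneg (Finset.range_subset_range.2 hs)
      fun d _ _ => hf d
  have hrow : ∀ i ∈ Finset.range M, ∑ j ∈ Finset.range M, f (i - j + (j - i)) ≤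
      2 * ∑ d ∈ Finset.range M, f d := by
    intro i hi
    have hiM : i + 1 ≤ M := Finset.mem_range.1 hi
    have h1 : ∑ j ∈ Finset.range (i + 1), f (i - j + (j - i)) =
        ∑ d ∈ Finset.range (i + 1), f d := by
      rw [← Finset.sum_range_reflect f (i + 1)]
      refine Finset.sum_congr rfl fun j hj => ?_
      rw [Finset.mem_range] at hj
      congr 1
      omega
    have h2 : ∑ j ∈ Finset.Ico (i + 1) M, f (i - j + (j - i)) =
        ∑ d ∈ Finset.range (M - (i + 1)), f (d + 1) := by
      rw [Finset.sum_Ico_eq_sum_range]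
      refine Finset.sum_congr rfl fun j _ => ?_
      congr 1
      omega
    have h3 : ∑ d ∈ Finset.range (M - (i + 1)), f (d + 1) ≤ ∑ d ∈ Finset.range M, f d := by
      refine le_trans ?_ (hmono (s := M - (i + 1) + 1) (by omega))
      rw [Finset.sum_range_succ']
      exact le_add_of_nonneg_right (hf 0)
    rw [← Finset.sum_range_add_sum_Ico _ hiM, h1, h2]
    linarith [hmono hiM]
  have := Finset.sum_le_card_nsmul _ _ _ hrow
  rw [Finset.card_range, nsmul_eq_mul] at this
  linarith

theorem sum_range_rpow_neg_le {θ : ℝ} (h0 : 0 < θ) (h1 : θ < 1) (M : ℕ) :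
    ∑ d ∈ Finset.range M, ((d + 1 : ℕ) : ℝ) ^ (-θ) ≤ (M : ℝ) ^ (1 - θ) / (1 - θ) := by
  induction M with
  | zero => simp [Real.zero_rpow (sub_pos.2 h1).ne']
  | succ M ih =>
    rw [Finset.sum_range_succ]
    have hpos : (0 : ℝ) < ((M + 1 : ℕ) : ℝ) := by positivity
    -- Bernoulli's inequality for `(M / (M + 1)) ^ (1 - θ)`.
    have hb := rpow_one_add_le_one_add_mul_self (s := -(1 / ((M + 1 : ℕ) : ℝ)))
      (by rw [neg_le_neg_iff, div_le_one hpos]; push_cast; linarith [M.cast_nonneg (α := ℝ)])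
      (sub_pos.2 h1).le (by linarith)
    have he : 1 + -(1 / ((M + 1 : ℕ) : ℝ)) = M / ((M + 1 : ℕ) : ℝ) := by
      field_simp
      push_cast
      ring
    rw [he, Real.div_rpow M.cast_nonneg hpos.le, div_le_iff₀ (by positivity)] at hb
    have hs : ((M + 1 : ℕ) : ℝ) ^ (1 - θ) = ((M + 1 : ℕ) : ℝ) * ((M + 1 : ℕ) : ℝ) ^ (-θ) := by
      rw [sub_eq_add_neg, Real.rpow_add hpos, Real.rpow_one]
    rw [le_div_iff₀ (sub_pos.2 h1)] at ih ⊢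
    have hx : (1 + (1 - θ) * -(1 / ((M + 1 : ℕ) : ℝ))) * ((M + 1 : ℕ) : ℝ) ^ (1 - θ) =
        ((M + 1 : ℕ) : ℝ) ^ (1 - θ) - (1 - θ) * ((M + 1 : ℕ) : ℝ) ^ (-θ) := by
      rw [hs]
      field_simp
      ring
    rw [hx] at hb
    linarith

theorem abs_measureReal_inter_sub_le_alphaCoeff (μ : Measure Ω) [IsProbabilityMeasure μ]
    (X : ℕ → Ω → ℝ) {T : Set ℝ} (hT : MeasurableSet T) (k n : ℕ) :
    |μ.real (X k ⁻¹' T ∩ X (k + n) ⁻¹' T) - μ.real (X k ⁻¹' T) * μ.real (X (k + n) ⁻¹' T)| ≤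
      alphaCoeff μ X n := by
  refine le_csSup (alphaValues_bddAbove μ X n) ⟨k, _, _, ?_, ?_, rfl⟩
  · exact (le_iSup₂_of_le (f := fun i (_ : i ∈ Set.Iic k) =>
      MeasurableSpace.comap (X i) (inferInstance : MeasurableSpace ℝ)) k
      (Set.mem_Iic.2 le_rfl) le_rfl) _ ⟨T, hT, rfl⟩
  · exact (le_iSup₂_of_le (f := fun i (_ : i ∈ Set.Ici (k + n)) =>
      MeasurableSpace.comap (X i) (inferInstance : MeasurableSpace ℝ)) (k + n)
      (Set.mem_Ici.2 le_rfl) le_rfl) _ ⟨T, hT, rfl⟩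

theorem alphaCoeff_nonneg (μ : Measure Ω) [IsProbabilityMeasure μ] (X : ℕ → Ω → ℝ) (n : ℕ) :
    0 ≤ alphaCoeff μ X n :=
  (abs_nonneg _).trans
    (abs_measureReal_inter_sub_le_alphaCoeff μ X MeasurableSet.empty 0 n)

theorem covariance_preimage_le_alphaCoeff (μ : Measure Ω) [IsProbabilityMeasure μ]
    (X : ℕ → Ω → ℝ) {T : Set ℝ} (hT : MeasurableSet T) (i j : ℕ) :
    μ.real (X i ⁻¹' T ∩ X j ⁻¹' T) - μ.real (X i ⁻¹' T) * μ.real (X j ⁻¹' T) ≤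
      alphaCoeff μ X (i - j + (j - i)) := by
  rcases le_total i j with h | h
  · obtain ⟨n, rfl⟩ := Nat.exists_eq_add_of_le h
    rw [show i - (i + n) + (i + n - i) = n by omega]
    exact (le_abs_self _).trans (abs_measureReal_inter_sub_le_alphaCoeff μ X hT i n)
  · obtain ⟨n, rfl⟩ := Nat.exists_eq_add_of_le h
    rw [show j + n - j + (j - (j + n)) = n by omega, Set.inter_comm, mul_comm]
    exact (le_abs_self _).trans (abs_measureReal_inter_sub_le_alphaCoeff μ X hT j n)

theorem sum_sum_alphaCoeff_le (μ : Measure Ω) [IsProbabilityMeasure μ] (X : ℕ → Ω → ℝ)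
    {K θ : ℝ} (hK : 0 < K) (h0 : 0 < θ) (h1 : θ < 1)
    (hα : ∀ n : ℕ, 1 ≤ n → alphaCoeff μ X n ≤ K * (n : ℝ) ^ (-θ)) {M : ℕ} (hM : 1 ≤ M) :
    ∑ i ∈ Finset.range M, ∑ j ∈ Finset.range M, alphaCoeff μ X (i - j + (j - i)) ≤
      2 * (alphaCoeff μ X 0 + K / (1 - θ)) * (M : ℝ) ^ (2 - θ) := by
  refine (sum_sum_dist_le (alphaCoeff_nonneg μ X) M).trans ?_
  have hM' : (1 : ℝ) ≤ M := by exact_mod_cast hM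
  have hone : 1 ≤ (M : ℝ) ^ (1 - θ) := Real.one_le_rpow hM' (by linarith)
  have hsum : ∑ d ∈ Finset.range M, alphaCoeff μ X d ≤
      (alphaCoeff μ X 0 + K / (1 - θ)) * (M : ℝ) ^ (1 - θ) := by
    calc ∑ d ∈ Finset.range M, alphaCoeff μ X d
        ≤ ∑ d ∈ Finset.range (M + 1), alphaCoeff μ X d :=
          Finset.sum_le_sum_of_subset_of_nonneg (Finset.range_subset_range.2 (by omega))
            fun d _ _ => alphaCoeff_nonneg μ X d
      _ = ∑ d ∈ Finset.range M, alphaCoeff μ X (d + 1) + alphaCoeff μ X 0 :=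
          Finset.sum_range_succ' _ _
      _ ≤ ∑ d ∈ Finset.range M, K * ((d + 1 : ℕ) : ℝ) ^ (-θ) +
            alphaCoeff μ X 0 * (M : ℝ) ^ (1 - θ) :=
          add_le_add (Finset.sum_le_sum fun d _ => hα (d + 1) (by omega))
            (le_mul_of_one_le_right (alphaCoeff_nonneg μ X 0) hone)
      _ ≤ K * ((M : ℝ) ^ (1 - θ) / (1 - θ)) + alphaCoeff μ X 0 * (M : ℝ) ^ (1 - θ) := by
          rw [← Finset.mul_sum]
          gcongr
          exact sum_range_rpow_neg_le h0 h1 M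
      _ = _ := by ring
  have hs : (M : ℝ) ^ (2 - θ) = M * (M : ℝ) ^ (1 - θ) := by
    rw [show 2 - θ = 1 + (1 - θ) by ring, Real.rpow_add (by linarith), Real.rpow_one]
  rw [hs]
  calc _ ≤ 2 * (M : ℝ) * ((alphaCoeff μ X 0 + K / (1 - θ)) * (M : ℝ) ^ (1 - θ)) := by gcongr
    _ = _ := by ring

/-! ### Almost sure decay of the normalised energy -/

theorem ae_tendsto_zero_of_summable_integral {μ : Measure Ω} {f : ℕ → Ω → ℝ} {b : ℕ → ℝ}
    (hf0 : ∀ m ω, 0 ≤ f m ω) (hf : ∀ m, Integrable (f m) μ) (hb : Summable b)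
    (hfb : ∀ m, ∫ ω, f m ω ∂μ ≤ b m) :
    ∀ᵐ ω ∂μ, Tendsto (fun m => f m ω) atTop (𝓝 0) := by
  have hmeas : ∀ m, AEMeasurable (fun ω => ENNReal.ofReal (f m ω)) μ := fun m =>
    (hf m).aestronglyMeasurable.aemeasurable.ennreal_ofReal
  have hlt : ∫⁻ ω, ∑' m, ENNReal.ofReal (f m ω) ∂μ ≠ ⊤ := by
    rw [lintegral_tsum hmeas]
    refine ne_top_of_le_ne_top hb.tsum_ofReal_ne_top (ENNReal.tsum_le_tsum fun m => ?_)
    rw [← ofReal_integral_eq_lintegral_ofReal (hf m) (Eventually.of_forall (hf0 m))]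
    exact ENNReal.ofReal_le_ofReal (hfb m)
  filter_upwards [ae_lt_top' (AEMeasurable.tsum hmeas) hlt] with ω hω
  have h := ENNReal.tendsto_atTop_zero_of_tsum_ne_top hω.ne
  have h' := (ENNReal.tendsto_toReal ENNReal.zero_ne_top).comp h
  simpa [Function.comp_def, ENNReal.toReal_ofReal, hf0] using h'

/-- The energy at scale `2 ^ m`, computed with `2 ^ (m + 1)` labels, has expectation at most a
polynomial in `m` times `(2 ^ m) ^ (2 - θ)`. After normalisation by `(2 ^ m) ^ (2 - 2 * r)` this is
geometrically small, whatever the labels `h m` are. -/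
theorem ae_tendsto_dyadicEnergy (μ : Measure Ω) [IsProbabilityMeasure μ] {X : ℕ → Ω → ℝ}
    (hX : ∀ i, Measurable (X i)) {r K θ : ℝ} (hr : 0 ≤ r) (hK : 0 < K) (hθ : 2 * r < θ)
    (h1 : θ < 1) (hα : ∀ n : ℕ, 1 ≤ n → alphaCoeff μ X n ≤ K * (n : ℝ) ^ (-θ))
    {h : ℕ → ℝ → ℕ} (hh : ∀ m, Measurable (h m)) :
    ∀ᵐ ω ∂μ, Tendsto (fun m : ℕ => ((2 : ℝ) ^ m) ^ (2 * (r - 1)) *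
      dyadicEnergy μ (fun i => h m ∘ X i) m (m + 1) ω) atTop (𝓝 0) := by
  have hY : ∀ m i, Measurable (h m ∘ X i) := fun m i => (hh m).comp (hX i)
  set C := alphaCoeff μ X 0 + K / (1 - θ)
  have hC0 : 0 ≤ C := add_nonneg (alphaCoeff_nonneg μ X 0) (div_nonneg hK.le (by linarith))
  set ρ : ℝ := 2 ^ (2 * r - θ) with hρ
  have hρ0 : 0 < ρ := by positivity
  have hρ1 : ρ < 1 := Real.rpow_lt_one_of_one_lt_of_neg one_lt_two (by linarith)
  have hsumm : Summable fun m : ℕ => (m : ℝ) ^ 4 * ρ ^ m :=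
    summable_pow_mul_geometric_of_norm_lt_one 4 (by rwa [Real.norm_of_nonneg hρ0.le])
  refine ae_tendsto_zero_of_summable_integral
    (f := fun m ω => ((2 : ℝ) ^ m) ^ (2 * (r - 1)) *
      dyadicEnergy μ (fun i => h m ∘ X i) m (m + 1) ω)
    (b := fun m : ℕ => 32 * C * ((m : ℝ) ^ 4 * ρ ^ m))
    (fun m ω => mul_nonneg (by positivity) (dyadicEnergy_nonneg _ _ _ _ _))
    (fun m => (integrable_dyadicEnergy μ (hY m) m (m + 1)).const_mul _)
    (hsumm.mul_left (32 * C)) fun m => ?_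
  have hE := integral_dyadicEnergy_le μ (hY m)
    (c := fun i j => alphaCoeff μ X (i - j + (j - i))) (fun i j => alphaCoeff_nonneg μ X _)
    (fun U i j => covariance_preimage_le_alphaCoeff μ X (hh m (MeasurableSet.of_discrete (s := U)))
      i j) m (m + 1)
  have hS := sum_sum_alphaCoeff_le μ X hK (by linarith) h1 hα (Nat.one_le_two_pow (n := m))
  have h2m : (0 : ℝ) < 2 ^ m := by positivity
  have hpow : ((2 : ℝ) ^ m) ^ (2 * (r - 1)) * ((2 : ℝ) ^ m) ^ (2 - θ) = ρ ^ m := by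
    rw [← Real.rpow_add h2m, hρ, ← Real.rpow_natCast, ← Real.rpow_natCast,
      ← Real.rpow_mul two_pos.le, ← Real.rpow_mul two_pos.le]
    congr 1
    ring
  have hm : (m : ℝ) ^ 2 * ((m + 1 : ℕ) : ℝ) ^ 2 ≤ 4 * (m : ℝ) ^ 4 := by
    rcases Nat.eq_zero_or_pos m with rfl | hm
    · simp
    · have : (1 : ℝ) ≤ m := by exact_mod_cast hm
      have h4 : ((m + 1 : ℕ) : ℝ) ^ 2 ≤ (2 * m) ^ 2 := by
        push_cast
        gcongr
        linarith
      calc (m : ℝ) ^ 2 * ((m + 1 : ℕ) : ℝ) ^ 2 ≤ (m : ℝ) ^ 2 * (2 * m) ^ 2 := by gcongr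
        _ = _ := by ring
  rw [integral_const_mul]
  push_cast at hS
  calc ((2 : ℝ) ^ m) ^ (2 * (r - 1)) * ∫ ω, dyadicEnergy μ (fun i => h m ∘ X i) m (m + 1) ω ∂μ
      ≤ ((2 : ℝ) ^ m) ^ (2 * (r - 1)) * (4 * (m : ℝ) ^ 2 * ((m + 1 : ℕ) : ℝ) ^ 2 *
        (2 * C * ((2 : ℝ) ^ m) ^ (2 - θ))) := by
        refine mul_le_mul_of_nonneg_left (hE.trans ?_) (by positivity)
        exact mul_le_mul_of_nonneg_left hS (by positivity)
    _ = 8 * C * ((m : ℝ) ^ 2 * ((m + 1 : ℕ) : ℝ) ^ 2) * (((2 : ℝ) ^ m) ^ (2 * (r - 1)) *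
        ((2 : ℝ) ^ m) ^ (2 - θ)) := by ring
    _ ≤ 8 * C * (4 * (m : ℝ) ^ 4) * ρ ^ m := by
        rw [hpow]
        gcongr
    _ = 32 * C * ((m : ℝ) ^ 4 * ρ ^ m) := by ring

/-! ### Bracketing half-lines by quantile labels -/

/-- The quantile label `⌈N F(y)⌉` of a real number `y`, where `F` is the distribution function
of `ν`. -/
noncomputable def upperLabel (ν : Measure ℝ) (N : ℕ) (y : ℝ) : ℕ := ⌈N * ν.real (Set.Iic y)⌉₊

/-- The quantile label `⌈N F(y-)⌉` of a real number `y`, built from the left limits of the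
distribution function of `ν`. It differs from `upperLabel` where `ν` has atoms. -/
noncomputable def lowerLabel (ν : Measure ℝ) (N : ℕ) (y : ℝ) : ℕ := ⌈N * ν.real (Set.Iio y)⌉₊

theorem monotone_upperLabel (ν : Measure ℝ) [IsProbabilityMeasure ν] (N : ℕ) :
    Monotone (upperLabel ν N) := fun _ _ hxy =>
  Nat.ceil_mono (mul_le_mul_of_nonneg_left (measureReal_mono (Set.Iic_subset_Iic.2 hxy))
    N.cast_nonneg)

theorem monotone_lowerLabel (ν : Measure ℝ) [IsProbabilityMeasure ν] (N : ℕ) :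
    Monotone (lowerLabel ν N) := fun _ _ hxy =>
  Nat.ceil_mono (mul_le_mul_of_nonneg_left (measureReal_mono (Set.Iio_subset_Iio hxy))
    N.cast_nonneg)

/-- Bounding a measure by its values on nonempty compact sets, which have a least and a greatest
element. -/
theorem measureReal_le_of_forall_isCompact (ν : Measure ℝ) [IsProbabilityMeasure ν] {A : Set ℝ}
    (hA : MeasurableSet A) {t : ℝ} (ht : 0 ≤ t)
    (h : ∀ C ⊆ A, IsCompact C → C.Nonempty → ν.real C ≤ t) : ν.real A ≤ t := by
  rw [measureReal_def, hA.measure_eq_iSup_isCompact_of_ne_top (measure_ne_top _ _)]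
  refine ENNReal.toReal_le_of_le_ofReal ht (iSup₂_le fun C hCA => iSup_le fun hC => ?_)
  rcases C.eq_empty_or_nonempty with rfl | hne
  · simp
  · rw [← ofReal_measureReal (measure_ne_top ν C)]
    exact ENNReal.ofReal_le_ofReal (h C hCA hC hne)

theorem measureReal_upperLabel_le (ν : Measure ℝ) [IsProbabilityMeasure ν] {N : ℕ} (hN : 0 < N)
    (k : ℕ) : ν.real {y | upperLabel ν N y ≤ k} ≤ k / N := by
  have hN' : (0 : ℝ) < N := by exact_mod_cast hN
  refine measureReal_le_of_forall_isCompact ν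
    (measurableSet_le (monotone_upperLabel ν N).measurable measurable_const) (by positivity) ?_
  intro C hCA hC hne
  have hmax := hCA (hC.sSup_mem hne)
  rw [Set.mem_ofPred_eq, upperLabel, Nat.ceil_le, mul_comm, ← le_div_iff₀ hN'] at hmax
  exact (measureReal_mono fun y hy => le_csSup hC.bddAbove hy).trans hmax

theorem le_measureReal_lowerLabel (ν : Measure ℝ) [IsProbabilityMeasure ν] {N : ℕ} (hN : 0 < N)
    {k : ℕ} (hk : k ≤ N) : (k : ℝ) / N ≤ ν.real {y | lowerLabel ν N y ≤ k} := by
  have hN' : (0 : ℝ) < N := by exact_mod_cast hN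
  have hmeas : MeasurableSet {y | lowerLabel ν N y ≤ k} :=
    measurableSet_le (monotone_lowerLabel ν N).measurable measurable_const
  suffices h : ν.real {y | lowerLabel ν N y ≤ k}ᶜ ≤ 1 - k / N by
    rw [probReal_compl_eq_one_sub hmeas] at h
    linarith
  refine measureReal_le_of_forall_isCompact ν hmeas.compl
    (sub_nonneg.2 ((div_le_one hN').2 (by exact_mod_cast hk))) ?_
  intro C hCA hC hne
  have hmin := hCA (hC.sInf_mem hne)
  rw [Set.mem_compl_iff, Set.mem_ofPred_eq, lowerLabel, Nat.ceil_le, not_le, mul_comm,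
    ← div_lt_iff₀ hN'] at hmin
  have hle : ν.real C ≤ ν.real (Set.Iio (sInf C))ᶜ :=
    measureReal_mono fun y hy => not_lt.2 (csInf_le hC.bddBelow hy)
  rw [probReal_compl_eq_one_sub measurableSet_Iio] at hle
  linarith

theorem indicator_Ici_le_indicator_Ici_of_imp {Ω : Type*} {Y : ℕ → Ω → ℕ}
    {i k : ℕ} {ω : Ω} {a x : ℝ}
    (h : a ≤ x → Y i ω < k) :
    (Set.Ici a).indicator (fun _ => (1 : ℝ)) x ≤
      (Y i ⁻¹' (Finset.range k : Finset ℕ)).indicator 1 ω := by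
  by_cases hx : a ≤ x
  · simp [hx, h hx]
  · rw [Set.indicator_of_notMem (by simpa using hx)]
    exact Set.indicator_nonneg (fun _ _ => zero_le_one) _

theorem indicator_le_indicator_Ici_of_imp {Ω : Type*} {Y : ℕ → Ω → ℕ}
    {i k : ℕ} {ω : Ω} {a x : ℝ}
    (h : Y i ω < k → a ≤ x) :
    (Y i ⁻¹' (Finset.range k : Finset ℕ)).indicator (1 : Ω → ℝ) ω ≤
      (Set.Ici a).indicator (fun _ => (1 : ℝ)) x := by
  by_cases hy : Y i ω < k
  · simp [hy, h hy]
  · rw [Set.indicator_of_notMem (by simpa using hy)]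
    exact Set.indicator_nonneg (fun _ _ => zero_le_one) _

theorem measureReal_preimage_eq {μ : Measure Ω} {X : ℕ → Ω → ℝ} (hX : ∀ i, Measurable (X i))
    (hid : ∀ i, IdentDistrib (X i) (X 0) μ μ) (i : ℕ) {T : Set ℝ} (hT : MeasurableSet T) :
    μ.real (X i ⁻¹' T) = (μ.map (X 0)).real T := by
  rw [← (hid i).map_eq, map_measureReal_apply (hX i) hT]

/-- The bracketing inequality. Let `k = upperLabel x`. The half-line `(-∞, x]` contains
`{lowerLabel < k}` and is contained in `{upperLabel < k + 1}`, and the probabilities of these two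
sets exceed or fall short of `F x` by at most the mesh `2 ^ (-m)`. Hence the deviation of the
empirical distribution function is controlled by the two energies up to the mesh. -/
theorem abs_empiricalCDF_sub_cdf_le (μ : Measure Ω) [IsProbabilityMeasure μ] {X : ℕ → Ω → ℝ}
    (hX : ∀ i, Measurable (X i)) (hid : ∀ i, IdentDistrib (X i) (X 0) μ μ) {m n : ℕ}
    (hm : 1 ≤ m) (hn0 : 0 < n) (hn : n < 2 ^ m) (ω : Ω) (x : ℝ) :
    |empiricalCDF X n ω x - cdf (μ.map (X 0)) x| ≤
      √(dyadicEnergy μ (fun i => upperLabel (μ.map (X 0)) (2 ^ m) ∘ X i) m (m + 1) ω +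
        dyadicEnergy μ (fun i => lowerLabel (μ.map (X 0)) (2 ^ m) ∘ X i) m (m + 1) ω) / n +
      1 / 2 ^ m := by
  have : IsProbabilityMeasure (μ.map (X 0)) :=
    Measure.isProbabilityMeasure_map (hX 0).aemeasurable
  set ν := μ.map (X 0)
  set N : ℕ := 2 ^ m with hN
  have hNpos : 0 < N := by positivity
  have hN' : (0 : ℝ) < N := by exact_mod_cast hNpos
  have hn' : (0 : ℝ) < n := by exact_mod_cast hn0
  have hU := (monotone_upperLabel ν N).measurable
  have hL := (monotone_lowerLabel ν N).measurable
  set E := dyadicEnergy μ (fun i => upperLabel ν N ∘ X i) m (m + 1) ω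
  set E' := dyadicEnergy μ (fun i => lowerLabel ν N ∘ X i) m (m + 1) ω
  have hE0 : 0 ≤ E := dyadicEnergy_nonneg _ _ _ _ _
  have hE0' : 0 ≤ E' := dyadicEnergy_nonneg _ _ _ _ _
  set k := upperLabel ν N x
  have hk_ge : (N : ℝ) * ν.real (Set.Iic x) ≤ k := Nat.le_ceil _
  have hk_lt : (k : ℝ) < N * ν.real (Set.Iic x) + 1 := Nat.ceil_lt_add_one (by positivity)
  have hkN : k ≤ N := Nat.ceil_le.2 (mul_le_of_le_one_right N.cast_nonneg measureReal_le_one)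
  have hNtwo : 2 ≤ N := by simpa using Nat.pow_le_pow_right two_pos hm
  have hN2 : 2 ^ (m + 1) = 2 * N := by rw [pow_succ, mul_comm]
  -- the two energies bound the centred counts of the two bracketing events
  have hD := Real.abs_le_sqrt ((sq_sum_deviation_le_dyadicEnergy μ
    (fun i => upperLabel ν N ∘ X i) hn (show k + 1 < 2 ^ (m + 1) by omega) ω).trans
    (le_add_of_nonneg_right hE0'))
  have hD' := Real.abs_le_sqrt ((sq_sum_deviation_le_dyadicEnergy μ
    (fun i => lowerLabel ν N ∘ X i) hn (show k < 2 ^ (m + 1) by omega) ω).trans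
    (le_add_of_nonneg_left hE0))
  simp only [sum_deviation μ (fun i => hU.comp (hX i))] at hD
  simp only [sum_deviation μ (fun i => hL.comp (hX i))] at hD'
  have hup : ∀ i, μ.real (upperLabel ν N ∘ X i ⁻¹' (Finset.range (k + 1) : Finset ℕ)) ≤
      ν.real (Set.Iic x) + 1 / N := by
    intro i
    rw [Set.preimage_comp, measureReal_preimage_eq hX hid i (hU (Finset.measurableSet _))]
    have heq : upperLabel ν N ⁻¹' (Finset.range (k + 1) : Finset ℕ) =
        {y | upperLabel ν N y ≤ k} := by
      ext y
      simp
    rw [heq]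
    refine (measureReal_upperLabel_le ν hNpos k).trans ?_
    rw [div_le_iff₀ hN', add_mul, one_div, inv_mul_cancel₀ hN'.ne']
    linarith
  have hlo : ∀ i, ν.real (Set.Iic x) - 1 / N ≤
      μ.real (lowerLabel ν N ∘ X i ⁻¹' (Finset.range k : Finset ℕ)) := by
    intro i
    rw [Set.preimage_comp, measureReal_preimage_eq hX hid i (hL (Finset.measurableSet _))]
    rcases Nat.eq_zero_or_pos k with h0 | hpos
    · refine le_trans ?_ measureReal_nonneg
      rw [h0, Nat.cast_zero] at hk_ge
      have := nonpos_of_mul_nonpos_right hk_ge hN'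
      have : 0 < 1 / (N : ℝ) := by positivity
      linarith
    · have heq : lowerLabel ν N ⁻¹' (Finset.range k : Finset ℕ) =
          {y | lowerLabel ν N y ≤ k - 1} := by
        ext y
        simp only [Set.mem_preimage, Finset.coe_range, Set.mem_Iio, Set.mem_ofPred_eq]
        omega
      rw [heq]
      refine le_trans ?_ (le_measureReal_lowerLabel ν hNpos (by omega : k - 1 ≤ N))
      rw [le_div_iff₀ hN', sub_mul, one_div, inv_mul_cancel₀ hN'.ne', Nat.cast_sub hpos,
        Nat.cast_one]
      linarith
  have hind : ∀ i, (Set.Ici (X i ω)).indicator (fun _ => (1 : ℝ)) x ≤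
      (upperLabel ν N ∘ X i ⁻¹' (Finset.range (k + 1) : Finset ℕ)).indicator 1 ω := fun i =>
    indicator_Ici_le_indicator_Ici_of_imp (Y := fun i => upperLabel ν N ∘ X i)
      fun h => Nat.lt_succ_of_le (monotone_upperLabel ν N h)
  have hind' : ∀ i, (lowerLabel ν N ∘ X i ⁻¹' (Finset.range k : Finset ℕ)).indicator 1 ω ≤
      (Set.Ici (X i ω)).indicator (fun _ => (1 : ℝ)) x := fun i =>
    indicator_le_indicator_Ici_of_imp (Y := fun i => lowerLabel ν N ∘ X i) fun h => by
      by_contra hlt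
      refine absurd h (not_lt.2 (Nat.ceil_mono (mul_le_mul_of_nonneg_left ?_ N.cast_nonneg)))
      exact measureReal_mono fun y hy => lt_of_le_of_lt hy (not_le.1 hlt)
  set R := √(E + E')
  have hsum : ∑ i ∈ Finset.range n, (Set.Ici (X i ω)).indicator (fun _ => (1 : ℝ)) x ≤
      R + n * (ν.real (Set.Iic x) + 1 / N) := by
    have h1 := Finset.sum_le_sum fun i (_ : i ∈ Finset.range n) => hind i
    have h2 := Finset.sum_le_sum fun i (_ : i ∈ Finset.range n) => hup i
    rw [Finset.sum_const, Finset.card_range, nsmul_eq_mul] at h2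
    have h3 := (abs_le.1 hD).2
    rw [Finset.sum_sub_distrib] at h3
    linarith
  have hsum' : n * (ν.real (Set.Iic x) - 1 / N) - R ≤
      ∑ i ∈ Finset.range n, (Set.Ici (X i ω)).indicator (fun _ => (1 : ℝ)) x := by
    have h1 := Finset.sum_le_sum fun i (_ : i ∈ Finset.range n) => hind' i
    have h2 := Finset.sum_le_sum fun i (_ : i ∈ Finset.range n) => hlo i
    rw [Finset.sum_const, Finset.card_range, nsmul_eq_mul] at h2
    have h3 := (abs_le.1 hD').1
    rw [Finset.sum_sub_distrib] at h3
    linarith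
  rw [cdf_eq_real, empiricalCDF, one_div_mul_eq_div]
  have hNc : (1 : ℝ) / 2 ^ m = 1 / N := by rw [hN]; push_cast; rfl
  rw [hNc, abs_le]
  constructor
  · have : (n * (ν.real (Set.Iic x) - 1 / N) - R) / n ≤ _ := div_le_div_of_nonneg_right hsum' hn'.le
    rw [sub_div, mul_div_cancel_left₀ _ hn'.ne'] at this
    linarith
  · have : _ ≤ (R + n * (ν.real (Set.Iic x) + 1 / N)) / n := div_le_div_of_nonneg_right hsum hn'.le
    rw [add_div, mul_div_cancel_left₀ _ hn'.ne'] at this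
    linarith

end EmpiricalMixing

theorem theorem2 {Ω : Type*} [MeasurableSpace Ω] (μ : Measure Ω) [IsProbabilityMeasure μ]
    (X : ℕ → Ω → ℝ) (hX : ∀ i, Measurable (X i))
    (hid : ∀ i, IdentDistrib (X i) (X 0) μ μ)
    (hmix : EmpiricalMixing.IsAlphaMixing μ X)
    (r : ℝ) (hr0 : 0 ≤ r) (hr : r < 1 / 2)
    (K θ : ℝ) (hK : 0 < K) (hθ : 2 * r < θ)
    (hα : ∀ n : ℕ, 1 ≤ n → EmpiricalMixing.alphaCoeff μ X n ≤ K * (n : ℝ) ^ (-θ)) :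
    ∀ᵐ ω ∂μ, Tendsto
      (fun n : ℕ => (n : ℝ) ^ r *
        EmpiricalMixing.supNorm
          (fun x => EmpiricalMixing.empiricalCDF X n ω x - cdf (μ.map (X 0)) x))
      atTop (𝓝 0) := by
  have : IsProbabilityMeasure (μ.map (X 0)) :=
    Measure.isProbabilityMeasure_map (hX 0).aemeasurable
  -- Lowering the exponent, one may assume `θ < 1`.
  obtain ⟨θ', hθ', hθ1, hle⟩ : ∃ θ', 2 * r < θ' ∧ θ' < 1 ∧ θ' ≤ θ :=
    ⟨min θ ((2 * r + 1) / 2), lt_min hθ (by linarith),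
      (min_le_right _ _).trans_lt (by linarith), min_le_left _ _⟩
  have hα' : ∀ n : ℕ, 1 ≤ n → EmpiricalMixing.alphaCoeff μ X n ≤ K * (n : ℝ) ^ (-θ') :=
    fun n hn => (hα n hn).trans (mul_le_mul_of_nonneg_left
      (Real.rpow_le_rpow_of_exponent_le (by exact_mod_cast hn) (neg_le_neg hle)) hK.le)
  have hU := EmpiricalMixing.ae_tendsto_dyadicEnergy μ hX hr0 hK hθ' hθ1 hα'
    (fun m => (EmpiricalMixing.monotone_upperLabel (μ.map (X 0)) (2 ^ m)).measurable)
  have hL := EmpiricalMixing.ae_tendsto_dyadicEnergy μ hX hr0 hK hθ' hθ1 hα'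
    (fun m => (EmpiricalMixing.monotone_lowerLabel (μ.map (X 0)) (2 ^ m)).measurable)
  filter_upwards [hU, hL] with ω hUω hLω
  set E : ℕ → ℝ := fun m =>
    EmpiricalMixing.dyadicEnergy μ
      (fun i => EmpiricalMixing.upperLabel (μ.map (X 0)) (2 ^ m) ∘ X i) m (m + 1) ω +
    EmpiricalMixing.dyadicEnergy μ
      (fun i => EmpiricalMixing.lowerLabel (μ.map (X 0)) (2 ^ m) ∘ X i) m (m + 1) ω with hE
  have hE0 : Tendsto (fun m : ℕ => ((2 : ℝ) ^ m) ^ (2 * (r - 1)) * E m) atTop (𝓝 0) := by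
    simpa only [hE, mul_add, add_zero] using hUω.add hLω
  have hpow0 : Tendsto (fun m : ℕ => ((2 : ℝ) ^ m) ^ (r - 1)) atTop (𝓝 0) := by
    have h := (tendsto_rpow_neg_atTop (show 0 < 1 - r by linarith)).comp
      (tendsto_pow_atTop_atTop_of_one_lt (one_lt_two (α := ℝ)))
    simpa only [neg_sub, Function.comp_def] using h
  have hbound : Tendsto (fun m : ℕ => 2 * √(((2 : ℝ) ^ m) ^ (2 * (r - 1)) * E m) +
      ((2 : ℝ) ^ m) ^ (r - 1)) atTop (𝓝 0) := by
    simpa using (hE0.sqrt.const_mul 2).add hpow0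
  have hlog : Tendsto (fun n : ℕ => Nat.log 2 n + 1) atTop atTop := by
    refine tendsto_atTop_atTop.2 fun b => ⟨2 ^ b, fun n hn => ?_⟩
    exact (Nat.le_log_of_pow_le one_lt_two hn).trans (Nat.le_succ _)
  refine tendsto_of_tendsto_of_tendsto_of_le_of_le' tendsto_const_nhds (hbound.comp hlog)
    (Eventually.of_forall fun n => mul_nonneg (by positivity)
      (Real.iSup_nonneg fun x => abs_nonneg _)) ?_
  filter_upwards [eventually_gt_atTop 0] with n hn0
  simp only [Function.comp_apply]
  set m := Nat.log 2 n + 1 with hm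
  have hnlt : n < 2 ^ m := Nat.lt_pow_succ_log_self one_lt_two n
  have hnge : 2 ^ m ≤ 2 * n := by
    rw [hm, pow_succ, mul_comm]
    exact Nat.mul_le_mul_left 2 (Nat.pow_log_le_self 2 hn0.ne')
  have hn' : (0 : ℝ) < n := by exact_mod_cast hn0
  have h2m : (0 : ℝ) < 2 ^ m := by positivity
  have hnltR : (n : ℝ) ≤ 2 ^ m := by exact_mod_cast hnlt.le
  have hngeR : (2 : ℝ) ^ m / 2 ≤ n := by
    have : (2 : ℝ) ^ m ≤ 2 * n := by exact_mod_cast hnge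
    linarith
  have hsup : EmpiricalMixing.supNorm
      (fun x => EmpiricalMixing.empiricalCDF X n ω x - cdf (μ.map (X 0)) x) ≤
      √(E m) / n + 1 / 2 ^ m :=
    ciSup_le fun x => EmpiricalMixing.abs_empiricalCDF_sub_cdf_le μ hX hid
      (Nat.succ_le_succ (Nat.zero_le _)) hn0 hnlt ω x
  have hsqrt : √(((2 : ℝ) ^ m) ^ (2 * (r - 1)) * E m) = ((2 : ℝ) ^ m) ^ (r - 1) * √(E m) := by
    rw [Real.sqrt_mul (by positivity), mul_comm 2, Real.rpow_mul h2m.le, Real.rpow_two,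
      Real.sqrt_sq (by positivity)]
  have hr1 : (n : ℝ) ^ r / n ≤ 2 * ((2 : ℝ) ^ m) ^ (r - 1) := by
    rw [← Real.rpow_sub_one hn'.ne']
    calc (n : ℝ) ^ (r - 1) ≤ ((2 : ℝ) ^ m / 2) ^ (r - 1) :=
          Real.rpow_le_rpow_of_nonpos (by positivity) hngeR (by linarith)
      _ = 2 ^ (1 - r) * ((2 : ℝ) ^ m) ^ (r - 1) := by
          rw [Real.div_rpow h2m.le two_pos.le, div_eq_mul_inv, ← Real.rpow_neg two_pos.le,
            neg_sub, mul_comm]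
      _ ≤ 2 ^ (1 : ℝ) * ((2 : ℝ) ^ m) ^ (r - 1) := by
          gcongr
          · exact one_le_two
          · linarith
      _ = _ := by rw [Real.rpow_one]
  have hr2 : (n : ℝ) ^ r / 2 ^ m ≤ ((2 : ℝ) ^ m) ^ (r - 1) := by
    rw [Real.rpow_sub_one h2m.ne']
    gcongr
  calc (n : ℝ) ^ r * EmpiricalMixing.supNorm
        (fun x => EmpiricalMixing.empiricalCDF X n ω x - cdf (μ.map (X 0)) x)
      ≤ (n : ℝ) ^ r * (√(E m) / n + 1 / 2 ^ m) := by gcongr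
    _ = (n : ℝ) ^ r / n * √(E m) + (n : ℝ) ^ r / 2 ^ m := by ring
    _ ≤ 2 * ((2 : ℝ) ^ m) ^ (r - 1) * √(E m) + ((2 : ℝ) ^ m) ^ (r - 1) := by gcongr
    _ = _ := by rw [hsqrt]; ring
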